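/- For integers $n,m\ge 1$ let $H_{n,m}=\sum_{k=1}^{n}\frac{1}{k^m}$ and $H_n=H_{n,1}$, and let $B_0,B_1,B_2,\dots$ be the Bernoulli numbers, given by $B_0=1$ and $\sum_{k=0}^{n}\binom{n+1}{k}B_k=0$ for $n\ge 1$. For rational numbers $a,b$ and a positive integer $N$, write $a\equiv b\pmod N$ if $a-b=Nc$ for some rational number $c$ whose reduced denominator is coprime to $N$. Then for every prime $p>5$, $$\sum_{k=1}^{p-1}\frac{H_k}{k\cdot 2^k}\equiv\frac{7}{24}\,p\,B_{p-3}\pmod{p^2}$$ and $$\sum_{k=1}^{p-1}\frac{H_{k,2}}{k\cdot 2^k}\equiv-\frac{3}{8}\,B_{p-3}\pmod{p}.$$ -/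

import Mathlib

/-- The harmonic number of order `m`: `H_{n,m} = ∑_{k=1}^{n} 1 / k ^ m`.
For `m = 1` this is Mathlib's `harmonic n`. -/
def harmonicOrder (n m : ℕ) : ℚ :=
  ∑ k ∈ Finset.Icc 1 n, 1 / (k : ℚ) ^ m

/-- Congruence of rational numbers modulo a natural number `n`: the difference `a - b` is `n` times
a rational number whose (reduced) denominator is coprime to `n`. -/
def RatModEq (n : ℕ) (a b : ℚ) : Prop :=
  ∃ c : ℚ, Nat.Coprime c.den n ∧ a - b = (n : ℚ) * c

/-! Modulo `p ^ 3`, `(-1)^k * choose (p-1) k` expands as `1 - p H_k + p^2 (H_k^2 - H_{k,2}) / 2`.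
Summing it against `1 / (k 2^k)` and comparing with the exact value of that binomial sum gives `p S
≡ H_{p-1} + p^2 U / 2`, where `S` is the first sum of the theorem and `U = ∑ (H_k^2 - H_{k,2}) / (k
2^k)`. The factor `p` on the left is why cubic precision is needed for a result modulo `p ^ 2`.

It remains to evaluate residues modulo `p` in terms of `e = ∑ H_k / k^2`, which is `B_{p-3}` by
Faulhaber's formula (`ratReduces_bernoulli_sub_three`). The reflection `k ↦ p - k` turns `1 / (k
2^k)` into a multiple of `2^k / k`. Since `choose (p-1) k` is `(-1)^k` modulo `p`, sums up to `p -
1` are binomial transforms; the transform exchanges division by the index with summation of `f k /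
k` and replaces `2^k` by `(-1)^k`. Everything then reduces to `e` and `A = ∑ (-1)^k / k^3`: with `T
= ∑ H_{k,2} / (k 2^k)`, one gets `4 T = -2 e - A` and `U + 2 T = -A`.

Finally `H_{p-1} / p^2 = -e / 3` and `H_{p-1,2} / p = 2 e / 3` (`exists_powerSum_eq`), and the
latter yields `2 A = -e` (`two_mul_altCubeSum`). Hence `T = -3 e / 8`, `U = 5 e / 4`, and `S / p`
has residue `-1/3 + 5/8 = 7/24` times `e`. -/

/-! ### Arithmetic of `p`-integral rationals -/

/-- `RatReduces p q z`: the rational number `q` is `p`-integral and its residue in `ZMod p`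
is `z`. -/
def RatReduces (p : ℕ) [Fact p.Prime] (q : ℚ) (z : ZMod p) : Prop :=
  (q.den : ZMod p) ≠ 0 ∧ (q : ZMod p) = z

namespace RatReduces

variable {p : ℕ} [Fact p.Prime] {q r : ℚ} {z w : ZMod p}

theorem congr (h : RatReduces p q z) (hq : q = r) (hz : z = w) : RatReduces p r w := by
  subst hq hz; exact h

theorem add (hq : RatReduces p q z) (hr : RatReduces p r w) : RatReduces p (q + r) (z + w) := by
  refine ⟨fun h => ?_, by rw [Rat.cast_add_of_ne_zero hq.1 hr.1, hq.2, hr.2]⟩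
  have h0 : ((q.den * r.den : ℕ) : ZMod p) = 0 := by
    rw [ZMod.natCast_eq_zero_iff] at h ⊢
    exact h.trans (Rat.add_den_dvd q r)
  push_cast at h0
  exact mul_ne_zero hq.1 hr.1 h0

theorem mul (hq : RatReduces p q z) (hr : RatReduces p r w) : RatReduces p (q * r) (z * w) := by
  refine ⟨fun h => ?_, by rw [Rat.cast_mul_of_ne_zero hq.1 hr.1, hq.2, hr.2]⟩
  have h0 : ((q.den * r.den : ℕ) : ZMod p) = 0 := by
    rw [ZMod.natCast_eq_zero_iff] at h ⊢
    exact h.trans (Rat.mul_den_dvd q r)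
  push_cast at h0
  exact mul_ne_zero hq.1 hr.1 h0

theorem intCast (n : ℤ) : RatReduces p (n : ℚ) (n : ZMod p) := by
  constructor <;> simp

theorem natCast (n : ℕ) : RatReduces p (n : ℚ) (n : ZMod p) := by
  constructor <;> simp

theorem neg (hq : RatReduces p q z) : RatReduces p (-q) (-z) :=
  ((intCast (-1)).mul hq).congr (by simp) (by simp)

theorem sub (hq : RatReduces p q z) (hr : RatReduces p r w) : RatReduces p (q - r) (z - w) :=
  (hq.add hr.neg).congr (by ring) (by ring)

theorem pow (hq : RatReduces p q z) (n : ℕ) : RatReduces p (q ^ n) (z ^ n) := by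
  induction n with
  | zero => exact (natCast 1).congr (by simp) (by simp)
  | succ n ih => exact (ih.mul hq).congr (by ring) (by ring)

theorem inv (hq : RatReduces p q z) (hz : z ≠ 0) : RatReduces p q⁻¹ z⁻¹ := by
  have hnum : (q.num : ZMod p) ≠ 0 := by
    intro h
    apply hz
    rw [← hq.2, Rat.cast_def, h, zero_div]
  have hq0 : q ≠ 0 := by rintro rfl; simp at hnum
  refine ⟨fun h => hnum ?_, by rw [Rat.cast_inv_of_ne_zero hnum, hq.2]⟩
  rw [ZMod.natCast_eq_zero_iff] at h
  rw [ZMod.intCast_zmod_eq_zero_iff_dvd] 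
  rw [Rat.den_inv_of_ne_zero hq0] at h
  exact Int.natCast_dvd.2 h

theorem div (hq : RatReduces p q z) (hr : RatReduces p r w) (hw : w ≠ 0) :
    RatReduces p (q / r) (z / w) := by
  simpa only [div_eq_mul_inv] using hq.mul (hr.inv hw)

theorem sum {ι : Type*} {s : Finset ι} {f : ι → ℚ} {g : ι → ZMod p}
    (h : ∀ i ∈ s, RatReduces p (f i) (g i)) : RatReduces p (∑ i ∈ s, f i) (∑ i ∈ s, g i) := by
  classical
  induction s using Finset.induction_on with
  | empty => exact (natCast 0).congr (by simp) (by simp)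
  | insert a s ha ih =>
    rw [Finset.sum_insert ha, Finset.sum_insert ha]
    exact (h a (by simp)).add (ih fun i hi => h i (by simp [hi]))

theorem unique (hq : RatReduces p q z) (hr : RatReduces p q w) : z = w := hq.2.symm.trans hr.2

theorem coprime (hq : RatReduces p q z) : Nat.Coprime q.den p := by
  have h := hq.1
  rw [Ne, ZMod.natCast_eq_zero_iff] at h
  exact ((Fact.out : p.Prime).coprime_iff_not_dvd.2 h).symm

theorem exists_eq_mul (hq : RatReduces p q 0) :
    ∃ c w, RatReduces p c w ∧ q = p * c := by
  have hp0 : (p : ℚ) ≠ 0 := by exact_mod_cast (Fact.out : p.Prime).ne_zero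
  have h := hq.2
  rw [Rat.cast_def, div_eq_zero_iff, or_iff_left hq.1, ZMod.intCast_zmod_eq_zero_iff_dvd] at h
  obtain ⟨n, hn⟩ := h
  refine ⟨n / q.den, _, (intCast n).div (natCast q.den) hq.1, ?_⟩
  rw [← mul_div_assoc, eq_div_iff (by exact_mod_cast q.den_ne_zero),
    Rat.mul_den_eq_num, hn]
  push_cast; ring

end RatReduces

/-- Congruence modulo `p ^ k` in the ring of `p`-integral rationals. -/
def RatCong (p : ℕ) [Fact p.Prime] (k : ℕ) (a b : ℚ) : Prop :=
  ∃ c z, RatReduces p c z ∧ a - b = (p : ℚ) ^ k * c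

namespace RatCong

variable {p : ℕ} [Fact p.Prime] {k : ℕ} {a b c d : ℚ} {z : ZMod p}

theorem refl (a : ℚ) : RatCong p k a a :=
  ⟨0, _, RatReduces.natCast 0 |>.congr (by simp) rfl, by simp⟩

theorem add (h : RatCong p k a b) (h' : RatCong p k c d) : RatCong p k (a + c) (b + d) := by
  obtain ⟨x, _, hx, ex⟩ := h
  obtain ⟨y, _, hy, ey⟩ := h'
  exact ⟨x + y, _, hx.add hy, by linear_combination ex + ey⟩

theorem mul_left (h : RatCong p k a b) (hc : RatReduces p c z) : RatCong p k (c * a) (c * b) := by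
  obtain ⟨x, _, hx, ex⟩ := h
  exact ⟨c * x, _, hc.mul hx, by linear_combination c * ex⟩

theorem sum {ι : Type*} {s : Finset ι} {f g : ι → ℚ} (h : ∀ i ∈ s, RatCong p k (f i) (g i)) :
    RatCong p k (∑ i ∈ s, f i) (∑ i ∈ s, g i) := by
  classical
  induction s using Finset.induction_on with
  | empty => exact refl _
  | insert a s ha ih =>
    rw [Finset.sum_insert ha, Finset.sum_insert ha]
    exact (h a (by simp)).add (ih fun i hi => h i (by simp [hi]))

end RatCong

/-! ### Binomial transform and its duality -/

section BinomialTransform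

variable {K : Type*} [Field K]

/-- The alternating binomial transform of a sequence. -/
def binomTransform (f : ℕ → K) (n : ℕ) : K :=
  ∑ k ∈ Finset.range (n + 1), (-1) ^ k * (n.choose k : K) * f k

/-- The sequence `f k / k`. -/
def divIndex (f : ℕ → K) (k : ℕ) : K := f k / k

/-- The partial sums `∑_{1 ≤ k ≤ n} f k / k`. -/
def sumDivIndex (f : ℕ → K) (n : ℕ) : K := ∑ k ∈ Finset.Icc 1 n, f k / k

@[simp] theorem divIndex_zero (f : ℕ → K) : divIndex f 0 = 0 := by simp [divIndex]

@[simp] theorem sumDivIndex_zero (f : ℕ → K) : sumDivIndex f 0 = 0 := by simp [sumDivIndex]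

theorem sumDivIndex_succ (f : ℕ → K) (n : ℕ) :
    sumDivIndex f (n + 1) = sumDivIndex f n + f (n + 1) / ((n + 1 : ℕ) : K) := by
  simp [sumDivIndex, Finset.sum_Icc_succ_top]

theorem binomTransform_zero (f : ℕ → K) : binomTransform f 0 = f 0 := by simp [binomTransform]

theorem binomTransform_congr {f g : ℕ → K} {n : ℕ} (h : ∀ k ≤ n, f k = g k) :
    binomTransform f n = binomTransform g n :=
  Finset.sum_congr rfl fun k hk => by rw [h k (by simpa [Nat.lt_succ_iff] using hk)]

/-- Termwise this is the absorption identity `(n+1) (choose (n+1) k - choose n k) = k choose (n+1)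
k`. -/
theorem binomTransform_succ_sub (g : ℕ → K) (n : ℕ) :
    ((n + 1 : ℕ) : K) * (binomTransform g (n + 1) - binomTransform g n) =
      binomTransform (fun k => k * g k) (n + 1) := by
  have h : binomTransform g n =
      ∑ k ∈ Finset.range (n + 2), (-1) ^ k * (n.choose k : K) * g k := by
    rw [Finset.sum_range_succ, Nat.choose_succ_self]
    simp [binomTransform]
  rw [h, binomTransform, binomTransform, ← Finset.sum_sub_distrib, Finset.mul_sum]
  refine Finset.sum_congr rfl fun k _ => ?_
  have key : ((n + 1 : ℕ) : K) * (((n + 1).choose k : K) - (n.choose k : K)) =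
      k * ((n + 1).choose k : K) := by
    cases k with
    | zero => simp
    | succ k =>
      have := Nat.add_one_mul_choose_eq n k
      rw [Nat.choose_succ_succ] at this ⊢
      have h2 := congrArg (Nat.cast : ℕ → K) this
      push_cast at h2 ⊢
      linear_combination h2
  linear_combination (-1) ^ k * g k * key

theorem mul_binomTransform (g : ℕ → K) (n : ℕ) :
    (n : K) * binomTransform g n = binomTransform (fun k => k * (g k - g (k - 1))) n := by
  have h : binomTransform (fun k => k * (g k - g (k - 1))) n =
      ∑ k ∈ Finset.range (n + 1), (-1) ^ k * (n.choose k : K) * (k * g k) -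
      ∑ k ∈ Finset.range (n + 1), (-1) ^ k * (n.choose k : K) * (k * g (k - 1)) := by
    rw [← Finset.sum_sub_distrib]
    exact Finset.sum_congr rfl fun k _ => by ring
  have h2 : ∑ k ∈ Finset.range (n + 1), (-1) ^ k * (n.choose k : K) * (k * g (k - 1)) =
      ∑ k ∈ Finset.range (n + 1),
        (-1) ^ (k + 1) * (n.choose (k + 1) : K) * ((k + 1 : ℕ) * g k) := by
    rw [Finset.sum_range_succ', Finset.sum_range_succ _ n, Nat.choose_succ_self]
    simp
  rw [h, h2, ← Finset.sum_sub_distrib, binomTransform, Finset.mul_sum]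
  refine Finset.sum_congr rfl fun k hk => ?_
  have hk' : k ≤ n := by simpa [Nat.lt_succ_iff] using hk
  have key := congrArg (Nat.cast : ℕ → K) (Nat.choose_succ_right_eq n k)
  push_cast [Nat.cast_sub hk'] at key ⊢
  linear_combination (-1) ^ k * g k * (-key)

/-- One half of the duality between `divIndex` and `sumDivIndex`. The bound `N` lets it apply in
`ZMod p`, where only indices below `p` are known to be invertible. -/
theorem binomTransform_divIndex {N : ℕ} (hN : ∀ k, 1 ≤ k → k ≤ N → (k : K) ≠ 0) {f : ℕ → K}
    (h0 : f 0 = 0) {n : ℕ} (hn : n ≤ N) :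
    binomTransform (divIndex f) n = sumDivIndex (binomTransform f) n := by
  induction n with
  | zero => simp [binomTransform_zero]
  | succ n ih =>
    have hne := hN (n + 1) (by omega) hn
    have h := binomTransform_succ_sub (divIndex f) n
    have h2 : binomTransform (fun k => k * divIndex f k) (n + 1) = binomTransform f (n + 1) := by
      refine binomTransform_congr fun k hk => ?_
      rcases Nat.eq_zero_or_pos k with rfl | hk0
      · simp [h0]
      · exact mul_div_cancel₀ _ (hN k hk0 (by omega))
    rw [h2, mul_comm, ← eq_div_iff hne, ih (by omega)] at h
    rw [sumDivIndex_succ]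
    linear_combination h

theorem binomTransform_sumDivIndex {N : ℕ} (hN : ∀ k, 1 ≤ k → k ≤ N → (k : K) ≠ 0) {f : ℕ → K}
    (h0 : f 0 = 0) {n : ℕ} (hn : n ≤ N) :
    binomTransform (sumDivIndex f) n = divIndex (binomTransform f) n := by
  rcases Nat.eq_zero_or_pos n with rfl | hn0
  · simp [binomTransform_zero]
  rw [divIndex, eq_div_iff (hN n hn0 hn), mul_comm, mul_binomTransform]
  refine binomTransform_congr fun k hk => ?_
  cases k with
  | zero => simp [h0]
  | succ k =>
    rw [sumDivIndex_succ, Nat.add_sub_cancel, add_sub_cancel_left,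
      mul_div_cancel₀ _ (hN _ (by omega) (by omega))]

/-- The binomial theorem at `x` and at `1`. Subtracting `1` makes the sequence vanish at index `0`,
as the duality requires. -/
theorem binomTransform_pow_sub_one (x : K) (n : ℕ) :
    binomTransform (fun k => x ^ k - 1) n = (1 - x) ^ n - 0 ^ n := by
  have h : ∀ y : K, ∑ k ∈ Finset.range (n + 1), (-1) ^ k * (n.choose k : K) * y ^ k =
      (1 - y) ^ n := fun y => by
    rw [sub_eq_neg_add, add_pow]
    exact Finset.sum_congr rfl fun k _ => by rw [neg_pow]; ring
  have h1 := h 1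
  rw [sub_self] at h1
  rw [← h x, ← h1, ← Finset.sum_sub_distrib, binomTransform]
  exact Finset.sum_congr rfl fun k _ => by ring

end BinomialTransform

/-! ### Reflection and reordering of nested sums -/

section FiniteSums

variable {K : Type*} [CommRing K]

theorem sum_Icc_reflect_tail (f : ℕ → K) {j N : ℕ} (hj : j ≤ N + 1) :
    ∑ k ∈ Finset.Icc j N, f k = ∑ k ∈ Finset.Icc 1 (N + 1 - j), f (N + 1 - k) := by
  refine Finset.sum_nbij' (fun k => N + 1 - k) (fun k => N + 1 - k) ?_ ?_ ?_ ?_ ?_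
  · intro k; simp only [Finset.mem_Icc]; omega
  · intro k; simp only [Finset.mem_Icc]; omega
  · intro k; simp only [Finset.mem_Icc]; omega
  · intro k; simp only [Finset.mem_Icc]; omega
  · intro k hk
    rw [Finset.mem_Icc] at hk
    congr 1; omega

theorem sum_Icc_reflect (f : ℕ → K) (N : ℕ) :
    ∑ k ∈ Finset.Icc 1 N, f k = ∑ k ∈ Finset.Icc 1 N, f (N + 1 - k) := by
  simpa using sum_Icc_reflect_tail f (j := 1) (N := N) (by omega)

theorem sum_Icc_mul_sum_swap (u v : ℕ → K) (N : ℕ) :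
    ∑ k ∈ Finset.Icc 1 N, u k * ∑ j ∈ Finset.Icc 1 k, v j =
      ∑ j ∈ Finset.Icc 1 N, v j * ∑ k ∈ Finset.Icc j N, u k := by
  simp only [Finset.mul_sum]
  rw [Finset.sum_comm' (t' := Finset.Icc 1 N) (s' := fun j => Finset.Icc j N)]
  · exact Finset.sum_congr rfl fun j _ => Finset.sum_congr rfl fun k _ => mul_comm _ _
  · intro k j; simp only [Finset.mem_Icc]; omega

theorem sum_Icc_mul_sum_reflect (u v : ℕ → K) (N : ℕ) :
    ∑ k ∈ Finset.Icc 1 N, u k * ∑ j ∈ Finset.Icc 1 k, v j =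
      ∑ j ∈ Finset.Icc 1 N, v (N + 1 - j) * ∑ k ∈ Finset.Icc 1 j, u (N + 1 - k) := by
  rw [sum_Icc_mul_sum_swap, sum_Icc_reflect]
  refine Finset.sum_congr rfl fun j hj => ?_
  rw [Finset.mem_Icc] at hj
  rw [sum_Icc_reflect_tail u (by omega), Nat.sub_sub_self (by omega)]

theorem sum_Icc_mul_sum_mul_sum_reflect (u v w : ℕ → K) (N : ℕ) :
    ∑ k ∈ Finset.Icc 1 N, u k * ∑ j ∈ Finset.Icc 1 k, v j * ∑ i ∈ Finset.Icc 1 j, w i =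
      ∑ i ∈ Finset.Icc 1 N, w (N + 1 - i) *
        ∑ j ∈ Finset.Icc 1 i, v (N + 1 - j) * ∑ k ∈ Finset.Icc 1 j, u (N + 1 - k) := by
  have h := sum_Icc_mul_sum_reflect
    (fun j => v j * ∑ k ∈ Finset.Icc 1 (N + 1 - j), u (N + 1 - k)) w N
  rw [sum_Icc_mul_sum_reflect u, sum_Icc_reflect]
  refine Eq.trans ?_ (h.trans ?_)
  · refine Finset.sum_congr rfl fun j hj => ?_
    rw [Finset.mem_Icc] at hj
    rw [Nat.sub_sub_self (by omega)]
    ring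
  · refine Finset.sum_congr rfl fun i hi => ?_
    rw [Finset.mem_Icc] at hi
    congr 1
    refine Finset.sum_congr rfl fun j hj => ?_
    rw [Finset.mem_Icc] at hj
    rw [Nat.sub_sub_self (by omega)]

theorem sum_Icc_tail (f : ℕ → K) {j N : ℕ} (hN : j ≤ N) :
    ∑ k ∈ Finset.Icc j N, f k =
      ∑ k ∈ Finset.Icc 1 N, f k - ∑ k ∈ Finset.Icc 1 j, f k + f j := by
  induction N, hN using Nat.le_induction with
  | base => simp
  | succ n hn ih =>
    rw [Finset.sum_Icc_succ_top (by omega), Finset.sum_Icc_succ_top (by omega), ih]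
    ring

/-- For `p = 2 * h + 1`, the odd indices below `p` are exactly the `p - 2 * k`. -/
theorem sum_Icc_two_mul_even_odd (f : ℕ → K) (h : ℕ) :
    ∑ k ∈ Finset.Icc 1 (2 * h), f k =
      ∑ k ∈ Finset.Icc 1 h, (f (2 * k) + f (2 * h + 1 - 2 * k)) := by
  have h1 : ∑ k ∈ Finset.Icc 1 (2 * h), f k =
      ∑ k ∈ Finset.Icc 1 h, f (2 * k) + ∑ k ∈ Finset.Icc 1 h, f (2 * k - 1) := by
    induction h with
    | zero => simp
    | succ n ih =>
      rw [show 2 * (n + 1) = 2 * n + 1 + 1 by ring, Finset.sum_Icc_succ_top (by omega),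
        Finset.sum_Icc_succ_top (by omega), ih, Finset.sum_Icc_succ_top (by omega),
        Finset.sum_Icc_succ_top (by omega), show 2 * (n + 1) = 2 * n + 1 + 1 by ring,
        Nat.add_sub_cancel]
      ring
  rw [h1, Finset.sum_add_distrib, sum_Icc_reflect (fun k => f (2 * k - 1))]
  congr 1
  refine Finset.sum_congr rfl fun k hk => ?_
  rw [Finset.mem_Icc] at hk
  congr 1; omega

theorem sum_Icc_two_mul_reflect (f : ℕ → K) (h : ℕ) :
    ∑ k ∈ Finset.Icc 1 (2 * h), f k =
      ∑ k ∈ Finset.Icc 1 h, (f k + f (2 * h + 1 - k)) := by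
  have h2 := sum_Icc_reflect_tail f (j := h + 1) (N := 2 * h) (by omega)
  have h3 : ∑ k ∈ Finset.Icc (h + 1) (2 * h), f k =
      ∑ k ∈ Finset.Icc 1 (2 * h), f k - ∑ k ∈ Finset.Icc 1 h, f k := by
    rcases Nat.eq_zero_or_pos h with rfl | hh
    · simp
    · rw [sum_Icc_tail f (j := h + 1) (by omega), Finset.sum_Icc_succ_top (by omega)]
      ring
  rw [show 2 * h + 1 - (h + 1) = h by omega] at h2
  rw [Finset.sum_add_distrib, ← h2, h3]
  ring

end FiniteSums

/-! ### Harmonic sums in a field -/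

section PowerSums

/-- The generalized harmonic numbers `∑_{1 ≤ k ≤ n} 1 / k ^ m` in a field. -/
def powerSum (K : Type*) [Field K] (m n : ℕ) : K := ∑ k ∈ Finset.Icc 1 n, 1 / (k : K) ^ m

variable {K : Type*} [Field K]

theorem powerSum_succ (m n : ℕ) :
    powerSum K m (n + 1) = powerSum K m n + 1 / ((n + 1 : ℕ) : K) ^ m :=
  Finset.sum_Icc_succ_top (by omega) _

theorem powerSum_zero (m : ℕ) : powerSum K m 0 = 0 := by simp [powerSum]

theorem two_mul_sum_powerSum_one_div (n : ℕ) :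
    2 * ∑ k ∈ Finset.Icc 1 n, 1 / (k : K) * powerSum K 1 k =
      powerSum K 1 n ^ 2 + powerSum K 2 n := by
  induction n with
  | zero => simp [powerSum_zero]
  | succ n ih =>
    rw [Finset.sum_Icc_succ_top (by omega), mul_add, ih]
    simp only [powerSum_succ, pow_one]
    generalize hx : ((n + 1 : ℕ) : K) = x
    ring

/-- The nested sum is the complete homogeneous symmetric polynomial of degree 3 in `1, 1/2, …, 1/n`,
here in terms of power sums. -/
theorem six_mul_sum_sum_powerSum (n : ℕ) :
    6 * ∑ k ∈ Finset.Icc 1 n, 1 / (k : K) * ∑ j ∈ Finset.Icc 1 k, 1 / (j : K) * powerSum K 1 j =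
      powerSum K 1 n ^ 3 + 3 * powerSum K 1 n * powerSum K 2 n + 2 * powerSum K 3 n := by
  induction n with
  | zero => simp [powerSum_zero]
  | succ n ih =>
    have h2 := two_mul_sum_powerSum_one_div (K := K) (n + 1)
    rw [Finset.sum_Icc_succ_top (by omega), mul_add, ih]
    simp only [powerSum_succ, pow_one] at h2 ⊢
    generalize hx : ((n + 1 : ℕ) : K) = x at h2 ⊢
    linear_combination 3 * (1 / x) * h2

theorem three_mul_sum_powerSum_sq_sub (n : ℕ) :
    3 * ∑ k ∈ Finset.Icc 1 n, (powerSum K 1 k ^ 2 - powerSum K 2 k) / (k : K) =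
      powerSum K 1 n ^ 3 - 3 * powerSum K 1 n * powerSum K 2 n - 4 * powerSum K 3 n +
        6 * ∑ k ∈ Finset.Icc 1 n, powerSum K 1 k / (k : K) ^ 2 := by
  induction n with
  | zero => simp [powerSum_zero]
  | succ n ih =>
    rw [Finset.sum_Icc_succ_top (by omega), mul_add, ih, Finset.sum_Icc_succ_top (by omega)]
    simp only [powerSum_succ, pow_one]
    generalize hx : ((n + 1 : ℕ) : K) = x
    ring

end PowerSums

theorem Nat.not_sub_one_dvd {p : ℕ} (hp5 : 5 < p) {m : ℕ} (h0 : 1 ≤ m) (h3 : m ≤ 3) :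
    ¬ p - 1 ∣ m :=
  fun h => by have := Nat.le_of_dvd (by omega) h; omega

/-! ### Evaluation of sums modulo `p` -/

section PrimeField

variable {p : ℕ} [hp : Fact p.Prime]

theorem ZMod.natCast_ne_zero_of_mem_Icc {k : ℕ} (hk : k ∈ Finset.Icc 1 (p - 1)) :
    (k : ZMod p) ≠ 0 := by
  rw [Finset.mem_Icc] at hk
  rw [Ne, ZMod.natCast_eq_zero_iff]
  intro h
  have := Nat.le_of_dvd (by omega) h
  have := hp.out.pos
  omega

theorem ZMod.natCast_sub_eq_neg {k : ℕ} (hk : k ≤ p) : ((p - k : ℕ) : ZMod p) = -k := by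
  rw [Nat.cast_sub hk, ZMod.natCast_self, zero_sub]

theorem ZMod.sum_Icc_eq_sum_units (f : ZMod p → ZMod p) :
    ∑ k ∈ Finset.Icc 1 (p - 1), f k = ∑ u : (ZMod p)ˣ, f u := by
  refine Finset.sum_bij' (fun k hk => Units.mk0 (k : ZMod p) (natCast_ne_zero_of_mem_Icc hk))
    (fun u _ => (u : ZMod p).val) ?_ ?_ ?_ ?_ ?_
  · intro k hk; simp
  · intro u _
    have h1 := ZMod.val_lt (u : ZMod p)
    have h2 : (u : ZMod p).val ≠ 0 := by
      rw [Ne, ZMod.val_eq_zero]; exact u.ne_zero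
    rw [Finset.mem_Icc]; omega
  · intro k hk
    rw [Finset.mem_Icc] at hk
    exact ZMod.val_cast_of_lt (by omega)
  · intro u _
    ext; simp
  · intro k hk; simp

theorem ZMod.sum_Icc_pow (m : ℕ) :
    ∑ k ∈ Finset.Icc 1 (p - 1), (k : ZMod p) ^ m = if p - 1 ∣ m then -1 else 0 := by
  classical
  rw [ZMod.sum_Icc_eq_sum_units (fun x => x ^ m), FiniteField.sum_pow_units, ZMod.card]

theorem ZMod.powerSum_eq_zero {m : ℕ} (hm : ¬ p - 1 ∣ m) : powerSum (ZMod p) m (p - 1) = 0 := by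
  have h := ZMod.sum_Icc_pow (p := p) m
  rw [if_neg hm] at h
  rw [powerSum, ZMod.sum_Icc_eq_sum_units (fun x => 1 / x ^ m), ← h,
    ZMod.sum_Icc_eq_sum_units (fun x => x ^ m), ← Equiv.sum_comp (Equiv.inv (ZMod p)ˣ)]
  exact Finset.sum_congr rfl fun u _ => by
    rw [Equiv.inv_apply, Units.val_inv_eq_inv_val, inv_pow, one_div, inv_inv]

/-- Successive binomial coefficients have ratio `(p-1-k) / (k+1)`, which is `-1` modulo `p`. -/
theorem ZMod.neg_one_pow_mul_choose {k : ℕ} (hk : k ≤ p - 1) :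
    (-1) ^ k * ((p - 1).choose k : ZMod p) = 1 := by
  induction k with
  | zero => simp
  | succ k ih =>
    have hne : ((k + 1 : ℕ) : ZMod p) ≠ 0 :=
      natCast_ne_zero_of_mem_Icc (Finset.mem_Icc.2 ⟨by omega, hk⟩)
    have h := congrArg (Nat.cast : ℕ → ZMod p) (Nat.choose_succ_right_eq (p - 1) k)
    rw [Nat.sub_sub, Nat.cast_mul, Nat.cast_mul,
      natCast_sub_eq_neg (show 1 + k ≤ p by omega)] at h
    have ih := ih (by omega)
    apply mul_right_cancel₀ hne
    push_cast at h ⊢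
    linear_combination (1 + (k : ZMod p)) * ih + (-1) ^ (k + 1) * h

theorem ZMod.sum_Icc_eq_binomTransform {f : ℕ → ZMod p} (h0 : f 0 = 0) :
    ∑ k ∈ Finset.Icc 1 (p - 1), f k = binomTransform f (p - 1) := by
  rw [binomTransform, Finset.sum_range_eq_add_Ico _ (by omega), h0, mul_zero, zero_add]
  refine Finset.sum_congr (by ext; simp only [Finset.mem_Icc, Finset.mem_Ico]; omega) fun k hk => ?_
  rw [Finset.mem_Ico] at hk
  rw [ZMod.neg_one_pow_mul_choose (by omega), one_mul]

theorem ZMod.two_ne_zero_of_lt (hp5 : 5 < p) : (2 : ZMod p) ≠ 0 := by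
  exact_mod_cast ZMod.natCast_ne_zero_of_mem_Icc (p := p) (k := 2)
    (Finset.mem_Icc.2 ⟨by omega, by omega⟩)

theorem ZMod.three_ne_zero_of_lt (hp5 : 5 < p) : (3 : ZMod p) ≠ 0 := by
  exact_mod_cast ZMod.natCast_ne_zero_of_mem_Icc (p := p) (k := 3)
    (Finset.mem_Icc.2 ⟨by omega, by omega⟩)

/-- The alternating sum of inverse cubes over the nonzero residues `1, …, p - 1`. -/
def altCubeSum (p : ℕ) [Fact p.Prime] : ZMod p :=
  ∑ k ∈ Finset.Icc 1 (p - 1), (-1) ^ k / (k : ZMod p) ^ 3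

theorem ZMod.natCast_ne_zero_of_le (k : ℕ) (h1 : 1 ≤ k) (h2 : k ≤ p - 1) : (k : ZMod p) ≠ 0 :=
  natCast_ne_zero_of_mem_Icc (Finset.mem_Icc.2 ⟨h1, h2⟩)

theorem neg_one_pow_prime_sub (hp5 : 5 < p) {j : ℕ} (hj : j ≤ p) :
    (-1 : ZMod p) ^ (p - j) = -(-1) ^ j := by
  have hodd : Odd p := hp.out.odd_of_ne_two (by omega)
  have h : (-1 : ZMod p) ^ (p - j) * (-1) ^ j = -1 := by
    rw [← pow_add, Nat.sub_add_cancel hj, hodd.neg_one_pow]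
  have h2 : (-1 : ZMod p) ^ j * (-1) ^ j = 1 := by
    rw [← pow_add]; exact (Even.add_self j).neg_one_pow
  linear_combination (-1 : ZMod p) ^ j * h - (-1 : ZMod p) ^ (p - j) * h2

/-- Twice the alternating double sum of weight `(1, 2)` is the alternating sum of inverse cubes. -/
theorem two_mul_alternating_double_sum (hp5 : 5 < p) :
    2 * ∑ k ∈ Finset.Icc 1 (p - 1), 1 / (k : ZMod p) *
      ∑ j ∈ Finset.Icc 1 k, (-1) ^ j / (j : ZMod p) ^ 2 = altCubeSum p := by
  have hP1 : powerSum (ZMod p) 1 (p - 1) = 0 :=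
    ZMod.powerSum_eq_zero (Nat.not_sub_one_dvd hp5 le_rfl (by omega))
  have h1 := sum_Icc_mul_sum_swap (fun k => 1 / (k : ZMod p))
    (fun j => (-1) ^ j / (j : ZMod p) ^ 2) (p - 1)
  have h2 := sum_Icc_mul_sum_reflect (fun k => 1 / (k : ZMod p))
    (fun j => (-1) ^ j / (j : ZMod p) ^ 2) (p - 1)
  have hp1 : p - 1 + 1 = p := by omega
  -- One copy is reordered with `H_{p-1} = 0` on the tail, the other is reflected; the terms in
  -- `H_j` cancel and only the diagonal `1 / j` survives.
  rw [two_mul]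
  nth_rewrite 1 [h1]
  rw [h2, ← Finset.sum_add_distrib, altCubeSum]
  refine Finset.sum_congr rfl fun j hj => ?_
  have hj0 := ZMod.natCast_ne_zero_of_mem_Icc hj
  rw [Finset.mem_Icc] at hj
  have h3 : ∑ k ∈ Finset.Icc 1 j, 1 / ((p - 1 + 1 - k : ℕ) : ZMod p) =
      -∑ k ∈ Finset.Icc 1 j, 1 / (k : ZMod p) := by
    rw [← Finset.sum_neg_distrib]
    refine Finset.sum_congr rfl fun k hk => ?_
    rw [Finset.mem_Icc] at hk
    rw [hp1, ZMod.natCast_sub_eq_neg (by omega), div_neg]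
  simp only [powerSum, pow_one] at hP1
  rw [sum_Icc_tail _ hj.2, hP1, h3, hp1, neg_one_pow_prime_sub hp5 (by omega),
    ZMod.natCast_sub_eq_neg (by omega)]
  field_simp
  ring

theorem two_pow_prime_sub (hp5 : 5 < p) {k : ℕ} (hk : k ≤ p) :
    (2 : ZMod p) ^ (p - k) = 2 / 2 ^ k := by
  have h2 := ZMod.two_ne_zero_of_lt hp5
  rw [eq_div_iff (pow_ne_zero _ h2), ← pow_add, Nat.sub_add_cancel hk, ZMod.pow_card]

theorem one_div_two_pow_reflect (hp5 : 5 < p) {k : ℕ} (hk : k ≤ p) :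
    1 / (((p - k : ℕ) : ZMod p) * 2 ^ (p - k)) = -(1 / 2) * (2 ^ k / k) := by
  have h2 := ZMod.two_ne_zero_of_lt hp5
  rw [ZMod.natCast_sub_eq_neg hk, two_pow_prime_sub hp5 hk]
  -- A zero residue is possible (`k = 0` or `k = p`); both sides are then `0` by the convention for
  -- division.
  rcases eq_or_ne (k : ZMod p) 0 with h | h
  · simp [h]
  · field_simp

theorem sumDivIndex_two_pow (k : ℕ) :
    sumDivIndex (fun k => (2 : ZMod p) ^ k) k =
      sumDivIndex (fun k => (2 : ZMod p) ^ k - 1) k + powerSum (ZMod p) 1 k := by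
  rw [sumDivIndex, sumDivIndex, powerSum, ← Finset.sum_add_distrib]
  exact Finset.sum_congr rfl fun k _ => by rw [pow_one]; ring

theorem binomTransform_two_pow_sub_one {k : ℕ} (hk : 1 ≤ k) :
    binomTransform (fun k => (2 : ZMod p) ^ k - 1) k = (-1) ^ k := by
  rw [binomTransform_pow_sub_one, zero_pow (by omega)]
  norm_num

/-- The residue of `∑ H_{k,2} / (k 2^k)`. -/
theorem four_mul_sum_powerSum_two_div (hp5 : 5 < p) :
    4 * ∑ k ∈ Finset.Icc 1 (p - 1), powerSum (ZMod p) 2 k / ((k : ZMod p) * 2 ^ k) =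
      -2 * ∑ k ∈ Finset.Icc 1 (p - 1), powerSum (ZMod p) 1 k / (k : ZMod p) ^ 2 -
        altCubeSum p := by
  have h2 := ZMod.two_ne_zero_of_lt hp5
  have hp1 : p - 1 + 1 = p := by omega
  have h1 : ∑ k ∈ Finset.Icc 1 (p - 1), powerSum (ZMod p) 2 k / ((k : ZMod p) * 2 ^ k) =
      -(1 / 2) * ∑ j ∈ Finset.Icc 1 (p - 1),
        1 / (j : ZMod p) ^ 2 * sumDivIndex (fun k => (2 : ZMod p) ^ k) j := by
    have h := sum_Icc_mul_sum_reflect (fun k => 1 / ((k : ZMod p) * 2 ^ k))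
      (fun j => 1 / (j : ZMod p) ^ 2) (p - 1)
    refine Eq.trans (Finset.sum_congr rfl fun k _ => ?_) (h.trans ?_)
    · rw [powerSum]; ring
    · rw [Finset.mul_sum]
      refine Finset.sum_congr rfl fun j hj => ?_
      rw [Finset.mem_Icc] at hj
      rw [hp1, ZMod.natCast_sub_eq_neg (by omega), neg_sq, mul_left_comm]
      congr 1
      rw [sumDivIndex, Finset.mul_sum]
      refine Finset.sum_congr rfl fun k hk => ?_
      rw [Finset.mem_Icc] at hk
      exact one_div_two_pow_reflect hp5 (by omega)
  -- Replacing `2^k` by `2^k - 1`, to which the duality applies, costs exactly the sum `∑ H_k /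
  -- k^2`.
  have h3 : ∑ j ∈ Finset.Icc 1 (p - 1),
        1 / (j : ZMod p) ^ 2 * sumDivIndex (fun k => (2 : ZMod p) ^ k) j =
      ∑ j ∈ Finset.Icc 1 (p - 1),
        divIndex (divIndex (sumDivIndex fun k => (2 : ZMod p) ^ k - 1)) j +
      ∑ k ∈ Finset.Icc 1 (p - 1), powerSum (ZMod p) 1 k / (k : ZMod p) ^ 2 := by
    rw [← Finset.sum_add_distrib]
    refine Finset.sum_congr rfl fun j _ => ?_
    rw [sumDivIndex_two_pow, divIndex, divIndex]
    ring
  have h4 : ∑ j ∈ Finset.Icc 1 (p - 1),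
        divIndex (divIndex (sumDivIndex fun k => (2 : ZMod p) ^ k - 1)) j =
      ∑ k ∈ Finset.Icc 1 (p - 1), 1 / (k : ZMod p) *
        ∑ j ∈ Finset.Icc 1 k, (-1) ^ j / (j : ZMod p) ^ 2 := by
    rw [ZMod.sum_Icc_eq_binomTransform (by simp),
      binomTransform_divIndex ZMod.natCast_ne_zero_of_le (by simp) le_rfl, sumDivIndex]
    refine Finset.sum_congr rfl fun k hk => ?_
    rw [Finset.mem_Icc] at hk
    rw [binomTransform_divIndex ZMod.natCast_ne_zero_of_le (by simp) hk.2, sumDivIndex, one_div_mul_eq_div]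
    congr 1
    refine Finset.sum_congr rfl fun j hj => ?_
    rw [Finset.mem_Icc] at hj
    rw [binomTransform_sumDivIndex ZMod.natCast_ne_zero_of_le (by simp) (hj.2.trans hk.2), divIndex,
      binomTransform_two_pow_sub_one hj.1]
    ring
  rw [h1, h3, h4, ← two_mul_alternating_double_sum hp5]
  field_simp
  ring

/-- The residue of the triple sum `∑ (H_k ^ 2 + H_{k,2}) / (k 2^k)`. -/
theorem sum_powerSum_sq_add_div (hp5 : 5 < p) :
    ∑ k ∈ Finset.Icc 1 (p - 1),
      (powerSum (ZMod p) 1 k ^ 2 + powerSum (ZMod p) 2 k) / ((k : ZMod p) * 2 ^ k) =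
      -altCubeSum p := by
  have h2 := ZMod.two_ne_zero_of_lt hp5
  have h3 := ZMod.three_ne_zero_of_lt hp5
  have hp1 : p - 1 + 1 = p := by omega
  have h1 : ∑ k ∈ Finset.Icc 1 (p - 1),
      (powerSum (ZMod p) 1 k ^ 2 + powerSum (ZMod p) 2 k) / ((k : ZMod p) * 2 ^ k) =
      - ∑ i ∈ Finset.Icc 1 (p - 1), 1 / (i : ZMod p) * ∑ j ∈ Finset.Icc 1 i,
        1 / (j : ZMod p) * sumDivIndex (fun k => (2 : ZMod p) ^ k) j := by
    have h := sum_Icc_mul_sum_mul_sum_reflect (fun k => 1 / ((k : ZMod p) * 2 ^ k))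
      (fun j => 1 / (j : ZMod p)) (fun j => 1 / (j : ZMod p)) (p - 1)
    have hl : ∑ k ∈ Finset.Icc 1 (p - 1),
      (powerSum (ZMod p) 1 k ^ 2 + powerSum (ZMod p) 2 k) / ((k : ZMod p) * 2 ^ k) =
      2 * ∑ k ∈ Finset.Icc 1 (p - 1), 1 / ((k : ZMod p) * 2 ^ k) *
        ∑ j ∈ Finset.Icc 1 k, 1 / (j : ZMod p) * ∑ i ∈ Finset.Icc 1 j, 1 / (i : ZMod p) := by
      rw [Finset.mul_sum]
      refine Finset.sum_congr rfl fun k _ => ?_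
      rw [← two_mul_sum_powerSum_one_div]
      simp only [powerSum, pow_one]
      ring
    rw [hl, h, Finset.mul_sum, ← Finset.sum_neg_distrib]
    refine Finset.sum_congr rfl fun i hi => ?_
    rw [Finset.mem_Icc] at hi
    rw [hp1, ZMod.natCast_sub_eq_neg (by omega), div_neg, Finset.mul_sum, Finset.mul_sum,
      Finset.mul_sum, ← Finset.sum_neg_distrib]
    refine Finset.sum_congr rfl fun j hj => ?_
    rw [Finset.mem_Icc] at hj
    have hs : ∑ k ∈ Finset.Icc 1 j, 1 / (((p - k : ℕ) : ZMod p) * 2 ^ (p - k)) =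
        -(1 / 2) * sumDivIndex (fun k => (2 : ZMod p) ^ k) j := by
      rw [sumDivIndex, Finset.mul_sum]
      refine Finset.sum_congr rfl fun k hk => ?_
      rw [Finset.mem_Icc] at hk
      exact one_div_two_pow_reflect hp5 (by omega)
    rw [hs, ZMod.natCast_sub_eq_neg (by omega), div_neg]
    field_simp
  -- The cost of replacing `2^k` by `2^k - 1`; here it vanishes because the power sums of exponents
  -- 1 and 3 do.
  have hz : ∑ k ∈ Finset.Icc 1 (p - 1), 1 / (k : ZMod p) *
      ∑ j ∈ Finset.Icc 1 k, 1 / (j : ZMod p) * powerSum (ZMod p) 1 j = 0 := by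
    have h := six_mul_sum_sum_powerSum (K := ZMod p) (p - 1)
    rw [ZMod.powerSum_eq_zero (Nat.not_sub_one_dvd hp5 le_rfl (by omega)),
      ZMod.powerSum_eq_zero (Nat.not_sub_one_dvd hp5 (by omega) le_rfl)] at h
    have h6 : (6 : ZMod p) ≠ 0 := by
      rw [show (6 : ZMod p) = 2 * 3 by norm_num]; exact mul_ne_zero h2 h3
    have h' := h.trans (show _ = (0 : ZMod p) by ring)
    exact (mul_eq_zero.1 h').resolve_left h6
  have h4 : ∑ i ∈ Finset.Icc 1 (p - 1), 1 / (i : ZMod p) * ∑ j ∈ Finset.Icc 1 i,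
        1 / (j : ZMod p) * sumDivIndex (fun k => (2 : ZMod p) ^ k) j =
      ∑ i ∈ Finset.Icc 1 (p - 1),
        divIndex (sumDivIndex (sumDivIndex fun k => (2 : ZMod p) ^ k - 1)) i := by
    rw [← add_zero (∑ i ∈ Finset.Icc 1 (p - 1), divIndex _ _), ← hz, ← Finset.sum_add_distrib]
    refine Finset.sum_congr rfl fun i _ => ?_
    rw [divIndex, sumDivIndex, one_div_mul_eq_div, one_div_mul_eq_div, ← add_div, ← Finset.sum_add_distrib]
    congr 1
    refine Finset.sum_congr rfl fun j _ => ?_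
    rw [sumDivIndex_two_pow]
    ring
  rw [h1, h4, ZMod.sum_Icc_eq_binomTransform (by simp),
      binomTransform_divIndex ZMod.natCast_ne_zero_of_le (by simp) le_rfl, sumDivIndex, altCubeSum]
  congr 1
  refine Finset.sum_congr rfl fun k hk => ?_
  rw [Finset.mem_Icc] at hk
  rw [binomTransform_sumDivIndex ZMod.natCast_ne_zero_of_le (by simp) hk.2, divIndex,
    binomTransform_sumDivIndex ZMod.natCast_ne_zero_of_le (by simp) hk.2, divIndex,
    binomTransform_two_pow_sub_one hk.1]
  ring

end PrimeField

/-! ### Congruences modulo powers of `p` -/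

section Reduction

variable {p : ℕ} [hp : Fact p.Prime]

theorem RatReduces.one_div_pow {k : ℕ} (hk : k ∈ Finset.Icc 1 (p - 1)) (m : ℕ) :
    RatReduces p (1 / (k : ℚ) ^ m) (1 / (k : ZMod p) ^ m) :=
  ((natCast 1).div ((natCast k).pow m)
    (pow_ne_zero _ (ZMod.natCast_ne_zero_of_mem_Icc hk))).congr (by simp) (by simp)

theorem RatReduces.powerSum (m : ℕ) {n : ℕ} (hn : n ≤ p - 1) :
    RatReduces p (powerSum ℚ m n) (powerSum (ZMod p) m n) :=
  .sum fun _ hk => .one_div_pow (Finset.Icc_subset_Icc_right hn hk) m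

theorem RatReduces.two : RatReduces p 2 2 := (natCast 2).congr (by simp) (by simp)

theorem RatReduces.one_div_mul_two_pow (hp5 : 5 < p) {k : ℕ} (hk : k ∈ Finset.Icc 1 (p - 1)) :
    RatReduces p (1 / ((k : ℚ) * 2 ^ k)) (1 / ((k : ZMod p) * 2 ^ k)) :=
  ((natCast 1).div ((natCast k).mul (two.pow k))
    (mul_ne_zero (ZMod.natCast_ne_zero_of_mem_Icc hk)
      (pow_ne_zero _ (ZMod.two_ne_zero_of_lt hp5)))).congr (by simp) (by simp)

/-- The expansion of the binomial coefficients of `p - 1` modulo `p ^ 3`. -/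
theorem ratCong_neg_one_pow_mul_choose (hp5 : 5 < p) {k : ℕ} (hk : k ≤ p - 1) :
    RatCong p 3 ((-1) ^ k * ((p - 1).choose k : ℚ))
      (1 - p * powerSum ℚ 1 k + p ^ 2 * ((powerSum ℚ 1 k ^ 2 - powerSum ℚ 2 k) / 2)) := by
  induction k with
  | zero => simpa [powerSum_zero] using RatCong.refl 1
  | succ k ih =>
    obtain ⟨c, z, hc, ec⟩ := ih (by omega)
    have hmem : k + 1 ∈ Finset.Icc 1 (p - 1) := Finset.mem_Icc.2 ⟨by omega, hk⟩
    have hinv := RatReduces.one_div_pow hmem 1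
    have hE := (((RatReduces.powerSum (p := p) 1 (n := k) (by omega)).pow 2).sub
      (RatReduces.powerSum (p := p) 2 (n := k) (by omega))).div RatReduces.two
      (ZMod.two_ne_zero_of_lt hp5)
    -- The next coefficient is `1 - p / (k+1)` times the previous one; the witness collects the old
    -- error and the new `p ^ 3` term of the product.
    refine ⟨c - c * (p * (1 / ((k + 1 : ℕ) : ℚ) ^ 1)) - 1 / ((k + 1 : ℕ) : ℚ) ^ 1 *
      ((powerSum ℚ 1 k ^ 2 - powerSum ℚ 2 k) / 2), _,
      (hc.sub (hc.mul ((RatReduces.natCast p).mul hinv))).sub (hinv.mul hE), ?_⟩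
    have hne : ((k + 1 : ℕ) : ℚ) ≠ 0 := by exact_mod_cast Nat.succ_ne_zero k
    have h := congrArg (Nat.cast : ℕ → ℚ) (Nat.choose_succ_right_eq (p - 1) k)
    rw [Nat.sub_sub, Nat.cast_mul, Nat.cast_mul, Nat.cast_sub (show 1 + k ≤ p by omega)] at h
    have h2 : ((p - 1).choose (k + 1) : ℚ) =
        ((p - 1).choose k : ℚ) * (p / ((k + 1 : ℕ) : ℚ) - 1) := by
      rw [eq_comm] at h
      field_simp
      push_cast at h ⊢
      linear_combination -h
    rw [h2]
    simp only [powerSum_succ, pow_one]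
    generalize ((k + 1 : ℕ) : ℚ) = x
    linear_combination (1 - p / x) * ec

theorem ratCong_sum_choose_mul (hp5 : 5 < p) {w : ℕ → ℚ} {v : ℕ → ZMod p}
    (hw : ∀ k ∈ Finset.Icc 1 (p - 1), RatReduces p (w k) (v k)) :
    RatCong p 3 (∑ k ∈ Finset.Icc 1 (p - 1), w k * ((-1) ^ k * ((p - 1).choose k : ℚ)))
      (∑ k ∈ Finset.Icc 1 (p - 1), w k - p * ∑ k ∈ Finset.Icc 1 (p - 1), w k * powerSum ℚ 1 k +
        p ^ 2 * ((∑ k ∈ Finset.Icc 1 (p - 1),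
          w k * (powerSum ℚ 1 k ^ 2 - powerSum ℚ 2 k)) / 2)) := by
  have h : RatCong p 3 _ _ := RatCong.sum fun k hk =>
    (ratCong_neg_one_pow_mul_choose hp5 (Finset.mem_Icc.1 hk).2).mul_left (hw k hk)
  convert h using 1
  rw [Finset.mul_sum, Finset.sum_div, Finset.mul_sum, ← Finset.sum_sub_distrib,
    ← Finset.sum_add_distrib]
  exact Finset.sum_congr rfl fun k _ => by ring

/-- The exact identity behind both weights: `x = 0` handles `1 / k`, and the fixed point `x = 1 / 2`
of `x ↦ 1 - x` handles `1 / (k 2^k)`. -/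
theorem sum_choose_mul_pow_sub_one_div (x : ℚ) (n : ℕ) :
    ∑ k ∈ Finset.Icc 1 n, (x ^ k - 1) / k * ((-1) ^ k * (n.choose k : ℚ)) =
      ∑ k ∈ Finset.Icc 1 n, (1 - x) ^ k / k := by
  have h := binomTransform_divIndex (K := ℚ) (N := n)
    (fun k hk _ => by exact_mod_cast (show k ≠ 0 by omega))
    (f := fun k => x ^ k - 1) (by simp) le_rfl
  rw [binomTransform, Finset.sum_range_eq_add_Ico _ (by omega), divIndex_zero, mul_zero, zero_add,
    sumDivIndex] at h
  refine Eq.trans ?_ (h.trans ?_)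
  · refine Finset.sum_congr (by ext; simp only [Finset.mem_Icc, Finset.mem_Ico]; omega)
      fun k _ => ?_
    rw [divIndex]; ring
  · refine Finset.sum_congr rfl fun k hk => ?_
    rw [Finset.mem_Icc] at hk
    rw [binomTransform_pow_sub_one, zero_pow (by omega), sub_zero]

theorem sum_choose_div (n : ℕ) :
    ∑ k ∈ Finset.Icc 1 n, 1 / (k : ℚ) ^ 1 * ((-1) ^ k * (n.choose k : ℚ)) =
      -powerSum ℚ 1 n := by
  have h := sum_choose_mul_pow_sub_one_div 0 n
  rw [powerSum, ← Finset.sum_neg_distrib]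
  have h2 := congrArg Neg.neg h
  rw [← Finset.sum_neg_distrib, ← Finset.sum_neg_distrib] at h2
  refine Eq.trans (Finset.sum_congr rfl fun k hk => ?_)
    (h2.trans (Finset.sum_congr rfl fun k _ => by simp))
  rw [Finset.mem_Icc] at hk
  rw [zero_pow (by omega)]; ring

theorem sum_choose_div_mul_two_pow (n : ℕ) :
    ∑ k ∈ Finset.Icc 1 n, 1 / ((k : ℚ) * 2 ^ k) * ((-1) ^ k * (n.choose k : ℚ)) =
      ∑ k ∈ Finset.Icc 1 n, 1 / ((k : ℚ) * 2 ^ k) - powerSum ℚ 1 n := by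
  have h := sum_choose_mul_pow_sub_one_div (1 / 2) n
  rw [sub_eq_add_neg, ← sum_choose_div, ← Finset.sum_add_distrib]
  have h3 : ∀ k : ℕ, (1 / 2 : ℚ) ^ k = 1 / 2 ^ k := fun k => by rw [div_pow, one_pow]
  have h4 : ∑ k ∈ Finset.Icc 1 n, (1 - 1 / 2 : ℚ) ^ k / k =
      ∑ k ∈ Finset.Icc 1 n, 1 / ((k : ℚ) * 2 ^ k) := by
    refine Finset.sum_congr rfl fun k _ => ?_
    rw [show (1 - 1 / 2 : ℚ) = 1 / 2 by norm_num, h3, div_div, mul_comm]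
  rw [Finset.sum_add_distrib, ← h4, ← h, ← Finset.sum_add_distrib]
  refine Finset.sum_congr rfl fun k _ => ?_
  rw [h3]; ring

theorem ratCong_one_div_sub {k : ℕ} (hk : k ∈ Finset.Icc 1 (p - 1)) :
    RatCong p 3 (1 / ((p - k : ℕ) : ℚ))
      (-(1 / (k : ℚ)) - p * (1 / (k : ℚ) ^ 2) - p ^ 2 * (1 / (k : ℚ) ^ 3)) := by
  have hk' := Finset.mem_Icc.1 hk
  have hk2 : p - k ∈ Finset.Icc 1 (p - 1) := Finset.mem_Icc.2 ⟨by omega, by omega⟩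
  -- The remainder of the geometric series for `1 / (p - k)` in powers of `p / k`.
  refine ⟨1 / (k : ℚ) ^ 3 * (1 / ((p - k : ℕ) : ℚ) ^ 1), _,
    (RatReduces.one_div_pow hk 3).mul (RatReduces.one_div_pow hk2 1), ?_⟩
  have h1 : (k : ℚ) ≠ 0 := by exact_mod_cast (show k ≠ 0 by omega)
  have h2 : ((p - k : ℕ) : ℚ) ≠ 0 := by exact_mod_cast (show p - k ≠ 0 by omega)
  rw [Nat.cast_sub (by omega)] at h2 ⊢
  field_simp
  ring

theorem ratCong_one_div_sub_sq {k : ℕ} (hk : k ∈ Finset.Icc 1 (p - 1)) :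
    RatCong p 2 (1 / ((p - k : ℕ) : ℚ) ^ 2)
      (1 / (k : ℚ) ^ 2 + 2 * p * (1 / (k : ℚ) ^ 3)) := by
  have hk' := Finset.mem_Icc.1 hk
  have hk2 : p - k ∈ Finset.Icc 1 (p - 1) := Finset.mem_Icc.2 ⟨by omega, by omega⟩
  -- From `k^3 - (k + 2p) (p - k)^2 = p^2 (3k - 2p)`.
  refine ⟨((3 * k - 2 * p : ℤ) : ℚ) * (1 / (k : ℚ) ^ 3 * (1 / ((p - k : ℕ) : ℚ) ^ 2)), _,
    (RatReduces.intCast _).mul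
      ((RatReduces.one_div_pow hk 3).mul (RatReduces.one_div_pow hk2 2)), ?_⟩
  have h1 : (k : ℚ) ≠ 0 := by exact_mod_cast (show k ≠ 0 by omega)
  have h2 : ((p - k : ℕ) : ℚ) ≠ 0 := by exact_mod_cast (show p - k ≠ 0 by omega)
  rw [Nat.cast_sub (by omega)] at h2 ⊢
  push_cast
  field_simp
  ring

theorem ratCong_two_mul_powerSum_one :
    RatCong p 3 (2 * powerSum ℚ 1 (p - 1))
      (-(p * powerSum ℚ 2 (p - 1)) - p ^ 2 * powerSum ℚ 3 (p - 1)) := by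
  have hp1 : p - 1 + 1 = p := by have := hp.out.pos; omega
  have h : RatCong p 3 _ _ := RatCong.sum fun k (hk : k ∈ Finset.Icc 1 (p - 1)) =>
    (RatCong.refl (p := p) (k := 3) (1 / (k : ℚ))).add (ratCong_one_div_sub hk)
  convert h using 1
  · have h2 := sum_Icc_reflect (fun k => 1 / (k : ℚ)) (p - 1)
    rw [hp1] at h2
    rw [Finset.sum_add_distrib, ← h2]
    simp only [powerSum, pow_one]
    ring
  · simp only [powerSum]
    rw [Finset.mul_sum, Finset.mul_sum, ← Finset.sum_neg_distrib, ← Finset.sum_sub_distrib]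
    exact Finset.sum_congr rfl fun k _ => by ring

theorem ratCong_powerSum_two_reflect {n : ℕ} (hn : p = 2 * n + 1) :
    RatCong p 2 (powerSum ℚ 2 (p - 1)) (2 * powerSum ℚ 2 n + 2 * p * powerSum ℚ 3 n) := by
  have h : RatCong p 2 _ _ := RatCong.sum fun k (hk : k ∈ Finset.Icc 1 n) =>
    (RatCong.refl (p := p) (k := 2) (1 / (k : ℚ) ^ 2)).add (ratCong_one_div_sub_sq (p := p)
      (Finset.Icc_subset_Icc_right (by omega) hk))
  convert h using 1
  · have h2 := sum_Icc_two_mul_reflect (fun k => 1 / (k : ℚ) ^ 2) n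
    rw [← hn] at h2
    rw [← h2, powerSum, show p - 1 = 2 * n by omega]
  · simp only [powerSum]
    rw [Finset.mul_sum, Finset.mul_sum, ← Finset.sum_add_distrib]
    exact Finset.sum_congr rfl fun k _ => by ring

theorem ratCong_powerSum_two_even_odd {n : ℕ} (hn : p = 2 * n + 1) :
    RatCong p 2 (powerSum ℚ 2 (p - 1)) (1 / 2 * powerSum ℚ 2 n + p / 4 * powerSum ℚ 3 n) := by
  have h : RatCong p 2 _ _ := RatCong.sum fun k (hk : k ∈ Finset.Icc 1 n) =>
    (RatCong.refl (p := p) (k := 2) (1 / ((2 * k : ℕ) : ℚ) ^ 2)).add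
      (ratCong_one_div_sub_sq (p := p) (k := 2 * k) (by
        rw [Finset.mem_Icc] at hk ⊢; omega))
  convert h using 1
  · have h2 := sum_Icc_two_mul_even_odd (fun k => 1 / (k : ℚ) ^ 2) n
    rw [← hn] at h2
    rw [← h2, powerSum, show p - 1 = 2 * n by omega]
  · simp only [powerSum]
    rw [Finset.mul_sum, Finset.mul_sum, ← Finset.sum_add_distrib]
    refine Finset.sum_congr rfl fun k _ => ?_
    push_cast
    rw [mul_pow, mul_pow]
    generalize (k : ℚ) = x
    ring

/-- The indices `2 * k` and `p - 2 * k` have opposite signs and opposite cubes modulo `p`, so each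
contributes `1 / (8 k^3)`. -/
theorem four_mul_altCubeSum (hp5 : 5 < p) {n : ℕ} (hn : p = 2 * n + 1) :
    4 * altCubeSum p = powerSum (ZMod p) 3 n := by
  have h2 := ZMod.two_ne_zero_of_lt hp5
  have h := sum_Icc_two_mul_even_odd (fun k => (-1) ^ k / (k : ZMod p) ^ 3) n
  rw [← hn, show 2 * n = p - 1 by omega] at h
  rw [altCubeSum, h, powerSum, Finset.mul_sum]
  refine Finset.sum_congr rfl fun k hk => ?_
  have hk0 := ZMod.natCast_ne_zero_of_mem_Icc (p := p)
    (Finset.Icc_subset_Icc_right (by omega) hk)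
  rw [Finset.mem_Icc] at hk
  rw [neg_one_pow_prime_sub hp5 (by omega), ZMod.natCast_sub_eq_neg (by omega), pow_mul]
  push_cast
  field_simp
  norm_num

end Reduction

/-! ### Bernoulli numbers modulo `p` -/

section Bernoulli

variable {p : ℕ} [hp : Fact p.Prime]

/-- In the recursion for `bernoulli' i` the denominators `i - k + 1` are at most `i + 1 < p`, so no
division by `p` occurs. -/
theorem exists_ratReduces_bernoulli {i : ℕ} (hi : i + 1 < p) :
    ∃ z, RatReduces p (bernoulli i) z := by
  have h : ∀ i, i + 1 < p → ∃ z, RatReduces p (bernoulli' i) z := by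
    intro i
    induction i using Nat.strong_induction_on with
    | _ i ih =>
      intro hi
      have hk : ∀ k ∈ Finset.range i, ∃ z,
          RatReduces p ((i.choose k : ℚ) / (i - k + 1) * bernoulli' k) z := by
        intro k hk
        rw [Finset.mem_range] at hk
        obtain ⟨z, hz⟩ := ih k hk (by omega)
        have hden := (RatReduces.natCast (p := p) (i - k + 1))
        refine ⟨_, (((RatReduces.natCast (i.choose k)).div hden
          (ZMod.natCast_ne_zero_of_le _ (by omega) (by omega))).mul hz).congr ?_ rfl⟩
        rw [Nat.cast_add, Nat.cast_sub hk.le, Nat.cast_one]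
      choose! z hz using hk
      rw [bernoulli'_def]
      exact ⟨_, ((RatReduces.natCast 1).sub (RatReduces.sum hz)).congr (by simp) rfl⟩
  obtain ⟨z, hz⟩ := h i hi
  exact ⟨_, ((RatReduces.intCast ((-1) ^ i)).mul hz).congr (by simp [bernoulli]) rfl⟩

/-- The Bernoulli number `B_{p-3}` modulo `p` as a double harmonic sum. -/
theorem ratReduces_bernoulli_sub_three (hp5 : 5 < p) :
    RatReduces p (bernoulli (p - 3))
      (∑ k ∈ Finset.Icc 1 (p - 1), powerSum (ZMod p) 1 k / (k : ZMod p) ^ 2) := by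
  have hB : ∀ i ∈ Finset.range (p - 2 + 1), ∃ z, RatReduces p (bernoulli i) z := fun i hi =>
    exists_ratReduces_bernoulli (by rw [Finset.mem_range] at hi; omega)
  choose! β hβ using hB
  have hneg : ((p - 1 : ℕ) : ZMod p) = -1 := by
    rw [ZMod.natCast_sub_eq_neg (by omega), Nat.cast_one]
  have hfermat : ∀ k ∈ Finset.Icc 1 (p - 1), (k : ZMod p) ^ (p - 1) = 1 := fun k hk =>
    ZMod.pow_card_sub_one_eq_one (ZMod.natCast_ne_zero_of_mem_Icc hk)
  -- Faulhaber's formula for exponent `p - 2`; its denominator `p - 1` reduces to `-1`. Since `j ^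
  -- (p-2)` is `1 / j`, this expresses `H_{k-1}` as a polynomial in `k`.
  have hF : ∀ k : ℕ, ∑ j ∈ Finset.range k, (j : ZMod p) ^ (p - 2) =
      -∑ i ∈ Finset.range (p - 2 + 1),
        β i * ((p - 1).choose i : ZMod p) * (k : ZMod p) ^ (p - 1 - i) := by
    intro k
    have h := sum_range_pow k (p - 2)
    have hl : RatReduces p (∑ j ∈ Finset.range k, (j : ℚ) ^ (p - 2))
        (∑ j ∈ Finset.range k, (j : ZMod p) ^ (p - 2)) :=
      .sum fun j _ => (RatReduces.natCast j).pow _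
    have hr : RatReduces p (∑ i ∈ Finset.range (p - 2 + 1), bernoulli i *
          ((p - 2 + 1).choose i : ℚ) * (k : ℚ) ^ (p - 2 + 1 - i) / ((p - 1 : ℕ) : ℚ)) _ :=
      .sum fun i hi => (((hβ i hi).mul (RatReduces.natCast _)).mul
        ((RatReduces.natCast k).pow _)).div (RatReduces.natCast (p - 1))
          (by rw [hneg]; exact neg_ne_zero.2 one_ne_zero)
    have hcast : ((p - 1 : ℕ) : ℚ) = ((p - 2 : ℕ) : ℚ) + 1 := by
      rw [show p - 1 = p - 2 + 1 by omega, Nat.cast_add, Nat.cast_one]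
    rw [hcast, ← h] at hr
    rw [hl.unique hr, ← Finset.sum_neg_distrib]
    refine Finset.sum_congr rfl fun i _ => ?_
    rw [hneg, show p - 2 + 1 = p - 1 by omega, div_neg, div_one]
  have hH : ∀ k ∈ Finset.Icc 1 (p - 1), powerSum (ZMod p) 1 k =
      ∑ j ∈ Finset.range k, (j : ZMod p) ^ (p - 2) + 1 / (k : ZMod p) := by
    intro k hk
    rw [Finset.mem_Icc] at hk
    obtain ⟨n, rfl⟩ : ∃ n, k = n + 1 := ⟨k - 1, by omega⟩
    rw [powerSum_succ, pow_one, powerSum, Finset.sum_range_eq_add_Ico _ (by omega), Nat.cast_zero,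
      zero_pow (by omega), zero_add]
    congr 1
    refine Finset.sum_congr (by ext; simp only [Finset.mem_Icc, Finset.mem_Ico]; omega)
      fun j hj => ?_
    rw [Finset.mem_Ico] at hj
    have hj' : j ∈ Finset.Icc 1 (p - 1) := Finset.mem_Icc.2 ⟨by omega, by omega⟩
    rw [pow_one, div_eq_iff (ZMod.natCast_ne_zero_of_mem_Icc hj'), ← pow_succ,
      show p - 2 + 1 = p - 1 by omega, hfermat j hj']
  have hP3 : ∑ k ∈ Finset.Icc 1 (p - 1), 1 / (k : ZMod p) ^ 3 = 0 :=
    ZMod.powerSum_eq_zero (Nat.not_sub_one_dvd hp5 (by omega) le_rfl)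
  have hsum : ∑ k ∈ Finset.Icc 1 (p - 1), powerSum (ZMod p) 1 k / (k : ZMod p) ^ 2 =
      -∑ i ∈ Finset.range (p - 2 + 1), β i * ((p - 1).choose i : ZMod p) *
        ∑ k ∈ Finset.Icc 1 (p - 1), (k : ZMod p) ^ (p - 3 + (p - 1 - i)) := by
    simp only [Finset.mul_sum]
    rw [Finset.sum_comm, ← Finset.sum_neg_distrib, ← add_zero (∑ _ ∈ _, -_), ← hP3,
      ← Finset.sum_add_distrib]
    refine Finset.sum_congr rfl fun k hk => ?_
    have hk0 := ZMod.natCast_ne_zero_of_mem_Icc hk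
    have hk2 : 1 / (k : ZMod p) ^ 2 = (k : ZMod p) ^ (p - 3) := by
      rw [div_eq_iff (pow_ne_zero _ hk0), ← pow_add, show p - 3 + 2 = p - 1 by omega, hfermat k hk]
    have e1 : ∑ i ∈ Finset.range (p - 2 + 1), β i * ((p - 1).choose i : ZMod p) *
        (k : ZMod p) ^ (p - 3 + (p - 1 - i)) = 1 / (k : ZMod p) ^ 2 *
        ∑ i ∈ Finset.range (p - 2 + 1), β i * ((p - 1).choose i : ZMod p) *
          (k : ZMod p) ^ (p - 1 - i) := by
      rw [hk2, Finset.mul_sum]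
      exact Finset.sum_congr rfl fun i _ => by rw [pow_add]; ring
    rw [e1, hH k hk, hF k]
    field_simp
  have hmem : p - 3 ∈ Finset.range (p - 2 + 1) := Finset.mem_range.2 (by omega)
  refine (hβ _ hmem).congr rfl ?_
  -- The exponent `2p - 4 - i` is a multiple of `p - 1` only for `i = p - 3`.
  rw [hsum, Finset.sum_eq_single_of_mem (p - 3) hmem]
  · rw [ZMod.sum_Icc_pow, if_pos ⟨1, by omega⟩]
    have h := ZMod.neg_one_pow_mul_choose (p := p) (k := p - 3) (by omega)
    have hev : (-1 : ZMod p) ^ (p - 3) = 1 := by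
      rw [neg_one_pow_prime_sub hp5 (by omega)]; norm_num
    rw [hev, one_mul] at h
    rw [h]; ring
  · intro i hi hne
    rw [Finset.mem_range] at hi
    rw [ZMod.sum_Icc_pow, if_neg, mul_zero]
    rintro ⟨c, hc⟩
    have hc0 : c ≠ 0 := by rintro rfl; omega
    have hc1 : c ≠ 1 := by rintro rfl; omega
    have hc2 : (p - 1) * 2 ≤ (p - 1) * c := Nat.mul_le_mul_left _ (by omega)
    omega

end Bernoulli

/-! ### Residues in terms of the Bernoulli number -/

section Main

variable {p : ℕ} [hp : Fact p.Prime]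

theorem RatReduces.ratModEq {q r : ℚ} {z : ZMod p} (hq : RatReduces p q z)
    (hr : RatReduces p r z) : RatModEq p q r := by
  obtain ⟨c, w, hc, e⟩ := ((hq.sub hr).congr rfl (sub_self z)).exists_eq_mul
  exact ⟨c, hc.coprime, e⟩

/-- The residues of `H_{p-1} / p^2` and `H_{p-1,2} / p`, given modulo `p`. -/
theorem exists_powerSum_eq (hp5 : 5 < p) :
    ∃ x y : ℚ, powerSum ℚ 1 (p - 1) = p ^ 2 * x ∧ powerSum ℚ 2 (p - 1) = p * y ∧
      RatReduces p x
        (-(1 / 3) * ∑ k ∈ Finset.Icc 1 (p - 1), powerSum (ZMod p) 1 k / (k : ZMod p) ^ 2) ∧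
      RatReduces p y
        (2 / 3 * ∑ k ∈ Finset.Icc 1 (p - 1), powerSum (ZMod p) 1 k / (k : ZMod p) ^ 2) := by
  have h2 := ZMod.two_ne_zero_of_lt hp5
  have h3 := ZMod.three_ne_zero_of_lt hp5
  have hp0 : (p : ℚ) ≠ 0 := by exact_mod_cast hp.out.ne_zero
  have z1 := ZMod.powerSum_eq_zero (Nat.not_sub_one_dvd hp5 le_rfl (by omega))
  have z3 := ZMod.powerSum_eq_zero (Nat.not_sub_one_dvd hp5 (m := 3) (by omega) le_rfl)
  obtain ⟨h1, _, r1, e1⟩ :=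
    ((RatReduces.powerSum (p := p) 1 le_rfl).congr rfl z1).exists_eq_mul
  obtain ⟨h3', _, r3, e3⟩ :=
    ((RatReduces.powerSum (p := p) 3 le_rfl).congr rfl z3).exists_eq_mul
  obtain ⟨c1, _, rc1, ec1⟩ := ratCong_sum_choose_mul hp5
    (w := fun k => 1 / (k : ℚ) ^ 1) fun k hk => RatReduces.one_div_pow hk 1
  obtain ⟨c2, _, rc2, ec2⟩ := ratCong_two_mul_powerSum_one (p := p)
  have hE : RatReduces p (∑ k ∈ Finset.Icc 1 (p - 1),
      1 / (k : ℚ) ^ 1 * (powerSum ℚ 1 k ^ 2 - powerSum ℚ 2 k))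
      (2 * ∑ k ∈ Finset.Icc 1 (p - 1), powerSum (ZMod p) 1 k / (k : ZMod p) ^ 2) := by
    refine RatReduces.congr (.sum fun k hk => (RatReduces.one_div_pow hk 1).mul
      (((RatReduces.powerSum 1 (Finset.mem_Icc.1 hk).2).pow 2).sub
        (RatReduces.powerSum 2 (Finset.mem_Icc.1 hk).2))) rfl ?_
    have h := three_mul_sum_powerSum_sq_sub (K := ZMod p) (p - 1)
    rw [z1, z3] at h
    apply mul_left_cancel₀ h3
    refine Eq.trans ?_ (h.trans (by ring))
    congr 1
    exact Finset.sum_congr rfl fun k _ => by ring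
  have hH := two_mul_sum_powerSum_one_div (K := ℚ) (p - 1)
  have hH' : ∑ k ∈ Finset.Icc 1 (p - 1), 1 / (k : ℚ) ^ 1 * powerSum ℚ 1 k =
      ∑ k ∈ Finset.Icc 1 (p - 1), 1 / (k : ℚ) * powerSum ℚ 1 k := by simp only [pow_one]
  rw [sum_choose_div, hH'] at ec1
  have hsum : ∑ k ∈ Finset.Icc 1 (p - 1), 1 / (k : ℚ) ^ 1 = powerSum ℚ 1 (p - 1) := rfl
  rw [hsum] at ec1
  generalize ∑ k ∈ Finset.Icc 1 (p - 1), powerSum (ZMod p) 1 k / (k : ZMod p) ^ 2 = e at *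
  generalize ∑ k ∈ Finset.Icc 1 (p - 1),
      1 / (k : ℚ) ^ 1 * (powerSum ℚ 1 k ^ 2 - powerSum ℚ 2 k) = E at *
  have r6 : RatReduces p 6 6 := (RatReduces.natCast 6).congr (by simp) (by simp)
  have h6 : (6 : ZMod p) ≠ 0 := by
    rw [show (6 : ZMod p) = 2 * 3 by norm_num]; exact mul_ne_zero h2 h3
  have rp : RatReduces p p 0 := (RatReduces.natCast p).congr rfl (by simp)
  -- The weight `1 / k` gives `2 H ≡ p (H^2 + H_2) / 2 - p^2 E / 2` and reflection gives `2 H ≡ -p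
  -- H_2 - p^2 H_3`. As `p` divides `H` and `H_3`, eliminating `H_2` leaves `6 H ≡ -p^2 E` modulo `p
  -- ^ 3`.
  have hx : powerSum ℚ 1 (p - 1) =
      p ^ 2 * ((p * (h1 ^ 2 - h3' - 2 * c1 + c2) - E) / 6) := by
    rw [mul_div_assoc', eq_div_iff (by norm_num)]
    have t1 : powerSum ℚ 1 (p - 1) ^ 2 = p ^ 2 * h1 ^ 2 := by rw [e1]; ring
    linear_combination -2 * ec1 + ec2 + p * hH + p * t1 - p ^ 2 * e3
  have rx : RatReduces p ((p * (h1 ^ 2 - h3' - 2 * c1 + c2) - E) / 6) (-(1 / 3) * e) := by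
    refine RatReduces.congr (((rp.mul ((((r1.pow 2).sub r3).sub
      (RatReduces.two.mul rc1)).add rc2)).sub hE).div r6 h6) rfl ?_
    field_simp
    ring
  refine ⟨_, -2 * ((p * (h1 ^ 2 - h3' - 2 * c1 + c2) - E) / 6) - p * h3' + p * c2, hx, ?_, rx, ?_⟩
  · apply mul_left_cancel₀ hp0
    linear_combination ec2 - 2 * hx - p ^ 2 * e3
  · refine RatReduces.congr (((RatReduces.two.neg.mul rx).sub (rp.mul r3)).add (rp.mul rc2))
      rfl ?_
    field_simp
    ring

theorem two_mul_altCubeSum (hp5 : 5 < p) :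
    2 * altCubeSum p =
      -∑ k ∈ Finset.Icc 1 (p - 1), powerSum (ZMod p) 1 k / (k : ZMod p) ^ 2 := by
  have h2 := ZMod.two_ne_zero_of_lt hp5
  have h3 := ZMod.three_ne_zero_of_lt hp5
  have hp0 : (p : ℚ) ≠ 0 := by exact_mod_cast hp.out.ne_zero
  obtain ⟨n, hn⟩ := hp.out.odd_of_ne_two (by omega)
  obtain ⟨x, y, -, ey, -, ry⟩ := exists_powerSum_eq hp5
  obtain ⟨c, _, rc, ec⟩ := ratCong_powerSum_two_reflect hn
  obtain ⟨d, _, rd, ed⟩ := ratCong_powerSum_two_even_odd hn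
  have rp : RatReduces p p 0 := (RatReduces.natCast p).congr rfl (by simp)
  -- Four times the even-odd congruence minus the reflected one eliminates `powerSum ℚ 2 n`.
  have hy : powerSum ℚ 3 n = (2 * 2 * d - c) * p - (2 + 1) * y := by
    apply mul_left_cancel₀ hp0
    linear_combination 4 * ed - ec - 3 * ey
  have h := (RatReduces.powerSum (p := p) 3 (n := n) (by omega)).unique
    (((((RatReduces.two.mul RatReduces.two).mul rd).sub rc).mul rp).sub
      ((RatReduces.two.add ((RatReduces.natCast 1).congr Nat.cast_one Nat.cast_one)).mul ry)
        |>.congr hy.symm rfl)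
  have h4 := four_mul_altCubeSum hp5 hn
  rw [h] at h4
  apply mul_left_cancel₀ (mul_ne_zero h2 h3)
  field_simp at h4
  linear_combination h4

end Main

theorem corollary1p2 (p : ℕ) (hp : p.Prime) (hp5 : 5 < p) :
    RatModEq (p ^ 2)
      (∑ k ∈ Finset.Icc 1 (p - 1), harmonic k / ((k : ℚ) * 2 ^ k))
      (7 / 24 * (p : ℚ) * bernoulli (p - 3)) ∧
    RatModEq p
      (∑ k ∈ Finset.Icc 1 (p - 1), harmonicOrder k 2 / ((k : ℚ) * 2 ^ k))
      (-(3 / 8) * bernoulli (p - 3)) := by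
  have : Fact p.Prime := ⟨hp⟩
  have h2 := ZMod.two_ne_zero_of_lt hp5
  have h3 := ZMod.three_ne_zero_of_lt hp5
  have hp0 : (p : ℚ) ≠ 0 := by exact_mod_cast hp.ne_zero
  have rB := ratReduces_bernoulli_sub_three hp5
  have hS := four_mul_sum_powerSum_two_div hp5
  have hQ := sum_powerSum_sq_add_div hp5
  have hA := two_mul_altCubeSum hp5
  have r2 : RatReduces p 2 2 := .two
  have r3 : RatReduces p 3 3 := (RatReduces.natCast 3).congr (by simp) (by simp)
  obtain ⟨x, -, ex, -, rx, -⟩ := exists_powerSum_eq hp5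
  have h8 : (2 : ZMod p) ^ 3 ≠ 0 := pow_ne_zero _ h2
  constructor
  · obtain ⟨c, _, rc, ec⟩ := ratCong_sum_choose_mul hp5
      (w := fun k => 1 / ((k : ℚ) * 2 ^ k)) fun k hk => RatReduces.one_div_mul_two_pow hp5 hk
    have rU : RatReduces p (∑ k ∈ Finset.Icc 1 (p - 1),
        1 / ((k : ℚ) * 2 ^ k) * (powerSum ℚ 1 k ^ 2 - powerSum ℚ 2 k)) _ :=
      .sum fun k hk => (RatReduces.one_div_mul_two_pow hp5 hk).mul
        (((RatReduces.powerSum 1 (Finset.mem_Icc.1 hk).2).pow 2).sub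
          (RatReduces.powerSum 2 (Finset.mem_Icc.1 hk).2))
    have hU : ∑ k ∈ Finset.Icc 1 (p - 1), 1 / ((k : ZMod p) * 2 ^ k) *
        (powerSum (ZMod p) 1 k ^ 2 - powerSum (ZMod p) 2 k) =
        ∑ k ∈ Finset.Icc 1 (p - 1),
          (powerSum (ZMod p) 1 k ^ 2 + powerSum (ZMod p) 2 k) / ((k : ZMod p) * 2 ^ k) -
        2 * ∑ k ∈ Finset.Icc 1 (p - 1), powerSum (ZMod p) 2 k / ((k : ZMod p) * 2 ^ k) := by
      rw [Finset.mul_sum, ← Finset.sum_sub_distrib]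
      exact Finset.sum_congr rfl fun k _ => by ring
    have hS1 : ∑ k ∈ Finset.Icc 1 (p - 1), 1 / ((k : ℚ) * 2 ^ k) * powerSum ℚ 1 k =
        ∑ k ∈ Finset.Icc 1 (p - 1), harmonic k / ((k : ℚ) * 2 ^ k) := by
      refine Finset.sum_congr rfl fun k _ => ?_
      rw [harmonic_eq_sum_Icc, powerSum, one_div_mul_eq_div]
      simp only [pow_one, one_div]
    rw [hU] at rU
    rw [sum_choose_div_mul_two_pow, hS1] at ec
    -- The residue of `S / p - 7/24 * B_{p-3}`, with `24` kept as `2^3 * 3` so that its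
    -- invertibility follows from that of `2` and `3`.
    have r0 := ((rx.add (rU.div r2 h2)).add ((RatReduces.natCast p).mul rc)).sub
      (((RatReduces.natCast 7).div ((r2.pow 3).mul r3) (mul_ne_zero h8 h3)).mul rB)
    obtain ⟨d, _, rd, ed⟩ := (r0.congr rfl (w := 0) (by
      rw [hQ, ZMod.natCast_self]
      field_simp
      push_cast
      linear_combination (-6) * hS - 3 * hA)).exists_eq_mul
    refine ⟨d, rd.coprime.pow_right 2, ?_⟩
    apply mul_left_cancel₀ hp0
    push_cast at ed ⊢
    linear_combination ec + ex + p ^ 2 * ed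
  · have rS : RatReduces p (∑ k ∈ Finset.Icc 1 (p - 1),
        1 / ((k : ℚ) * 2 ^ k) * powerSum ℚ 2 k) _ :=
      .sum fun k hk => (RatReduces.one_div_mul_two_pow hp5 hk).mul
        (RatReduces.powerSum 2 (Finset.mem_Icc.1 hk).2)
    refine RatReduces.ratModEq
      (rS.congr (Finset.sum_congr rfl fun k _ => one_div_mul_eq_div _ _) ?_)
      (((r3.div (r2.pow 3) h8).neg.mul rB).congr (by norm_num) rfl)
    simp only [one_div_mul_eq_div]
    field_simp
    linear_combination 2 * hS - hA
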